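/- Let $X$ and $Y$ be Banach spaces over the same field of scalars, $\mathbb{R}$ or $\mathbb{C}$, and let $\mathcal{L}(X,Y)$ be the set of bounded linear operators from $X$ to $Y$. Let $\Phi_-(X,Y)$ be the set of lower semi-Fredholm operators, that is, of all $T\in\mathcal{L}(X,Y)$ whose range is closed and of finite codimension in $Y$. Let $P\Phi_-(X,Y)$ be its perturbation class, that is, the set of all $K\in\mathcal{L}(X,Y)$ such that $T+K\in\Phi_-(X,Y)$ for every $T\in\Phi_-(X,Y)$. Let $\mathcal{SC}(X,Y)$ be the set of strictly cosingular operators, that is, of all $K\in\mathcal{L}(X,Y)$ such that for no closed infinite-codimensional subspace $Z$ of $Y$ is $Q_ZK$ surjective, where $Q_Z\colon Y\to Y/Z$ is the quotient operator. Suppose that $\Phi_-(X,Y)$ is not empty and that $Y$ is superprojective, that is, every closed infinite-codimensional subspace of $Y$ is contained in an infinite-codimensional subspace that is complemented in $Y$ (the range of a bounded linear projection on $Y$). Then $$P\Phi_-(X,Y)=\mathcal{SC}(X,Y).$$ -/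

import Mathlib

namespace SemiFredholm

variable {𝕜 X Y : Type*} [RCLike 𝕜]
  [NormedAddCommGroup X] [NormedSpace 𝕜 X] [NormedAddCommGroup Y] [NormedSpace 𝕜 Y]

/-- A subspace of infinite codimension: the quotient is infinite-dimensional. -/
def InfiniteCodim (M : Submodule 𝕜 X) : Prop := ¬ FiniteDimensional 𝕜 (X ⧸ M)

variable (𝕜 X Y) in
/-- `Φ₋(X, Y)`: the lower semi-Fredholm operators, i.e. the bounded operators whose range is
closed and finite-codimensional. -/
def lowerSemiFredholm : Set (X →L[𝕜] Y) :=
  {T | IsClosed (T.range : Set Y) ∧ FiniteDimensional 𝕜 (Y ⧸ T.range)}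

/-- The perturbation class of a set `𝒜` of operators from `X` to `Y`: all operators `K` such that
`T + K ∈ 𝒜` for every `T ∈ 𝒜`. -/
def perturbationClass (𝒜 : Set (X →L[𝕜] Y)) : Set (X →L[𝕜] Y) :=
  {K | ∀ T ∈ 𝒜, T + K ∈ 𝒜}

variable (𝕜 X Y) in
/-- `SC(X, Y)`: the strictly cosingular operators. For no closed infinite-codimensional subspace
`Z` of `Y` is the composition of the operator with the quotient map `Y → Y ⧸ Z` surjective. -/
def strictlyCosingular : Set (X →L[𝕜] Y) :=
  {K | ∀ Z : Submodule 𝕜 Y, IsClosed (Z : Set Y) → InfiniteCodim Z →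
    ¬ Function.Surjective (fun x : X => Z.mkQ (K x))}

variable (𝕜 X) in
/-- Every closed infinite-codimensional subspace is contained in an infinite-codimensional
complemented subspace (the range of a bounded projection). -/
def Superprojective : Prop :=
  ∀ M : Submodule 𝕜 X, IsClosed (M : Set X) → InfiniteCodim M →
    ∃ N : Submodule 𝕜 X, M ≤ N ∧ InfiniteCodim N ∧ N.ClosedComplemented

end SemiFredholm

namespace SemiFredholm

open Filter Topology

variable {𝕜 X Y : Type*} [RCLike 𝕜]
  [NormedAddCommGroup X] [NormedSpace 𝕜 X] [NormedAddCommGroup Y] [NormedSpace 𝕜 Y]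

/-! The engine is `exists_small_perturbation_mapsTo`: when S(E) has infinite codimension, there are
biorthogonal f_n, y_n with ‖f_n ∘ S|_E‖‖y_n‖ summably small. Extending f_n ∘ S|_E to g_n and setting
C = Σ g_n ⊗ y_n puts (S - C)(E) inside ⋂ ker f_n.

SC ⊆ PΦ₋: if T ∈ Φ₋ but T + K ∉ Φ₋, a small C keeps T - C in Φ₋ and sends T + K - C into some W.
Modulo W, -K equals T - C, so K is onto modulo W plus a finite-dimensional space.

PΦ₋ ⊆ SC: if K is onto modulo Z, enlarge Z to a complemented N and let E = K⁻¹(N). The class PΦ₋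
absorbs operators on Y from the left, so some B ∘ K is sought that moves a member of Φ₋ into an
infinite-codimensional subspace. If T(E) has infinite codimension, a perturbed T agrees on E, modulo
a complemented N₁, with 0, and the rest factors through K; otherwise the projection P with kernel N
gives RT - PK ∈ Φ₋, where R = 1 - P, and adding PK leaves RT, with range in N. -/

/-- A bounded operator on a Banach space is onto if every point has an approximate preimage of
controlled norm. -/
theorem surjective_of_approx_preimage [CompleteSpace X] (f : X →L[𝕜] Y) (C : ℝ)
    (h : ∀ y, ∃ x, ‖y - f x‖ ≤ 1 / 2 * ‖y‖ ∧ ‖x‖ ≤ C * ‖y‖) : Function.Surjective f := by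
  choose g hg hgn using h
  intro y
  let r : Y → Y := fun z => z - f (g z)
  have hC : 0 ≤ C * ‖y‖ := (norm_nonneg _).trans (hgn y)
  have hr : ∀ n : ℕ, ‖r^[n] y‖ ≤ (1 / 2) ^ n * ‖y‖ := by
    intro n
    induction n with
    | zero => simp
    | succ n ih =>
      rw [Function.iterate_succ_apply', pow_succ', mul_assoc]
      exact (hg _).trans (by gcongr)
  have hu : ∀ n, ‖g (r^[n] y)‖ ≤ (1 / 2) ^ n * (C * ‖y‖) := by
    intro n
    rcases eq_or_ne y 0 with rfl | hy
    · have h0 : r^[n] 0 = 0 := by simpa using hr n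
      simpa [h0] using hgn 0
    · have hC' : 0 ≤ C := nonneg_of_mul_nonneg_left hC (norm_pos_iff.2 hy)
      calc ‖g (r^[n] y)‖ ≤ C * ‖r^[n] y‖ := hgn _
        _ ≤ C * ((1 / 2) ^ n * ‖y‖) := by gcongr; exact hr n
        _ = _ := by ring
  have su : Summable fun n => g (r^[n] y) :=
    .of_norm_bounded (summable_geometric_two.mul_right _) hu
  have hsum : ∀ n : ℕ, f (∑ i ∈ Finset.range n, g (r^[i] y)) = y - r^[n] y := by
    intro n
    induction n with
    | zero => simp
    | succ n ih =>
      rw [Finset.sum_range_succ, map_add, ih, Function.iterate_succ_apply']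
      simp only [r]
      abel
  have hlim : Tendsto (fun n => r^[n] y) atTop (𝓝 0) := by
    refine squeeze_zero_norm hr ?_
    simpa using (tendsto_pow_atTop_nhds_zero_of_lt_one (r := (1 / 2 : ℝ)) (by norm_num)
      (by norm_num)).mul_const ‖y‖
  refine ⟨∑' n, g (r^[n] y), tendsto_nhds_unique
    ((f.continuous.tendsto _).comp su.hasSum.tendsto_sum_nat) ?_⟩
  simpa [Function.comp_def, hsum] using tendsto_const_nhds.sub hlim

/-! ### Finite codimension and openness of Φ₋ -/

/-- A submodule has finite codimension iff it spans the whole space together with a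
finite-dimensional one. -/
theorem finiteDimensional_quotient_iff (R : Submodule 𝕜 Y) :
    FiniteDimensional 𝕜 (Y ⧸ R) ↔
      ∃ F : Submodule 𝕜 Y, FiniteDimensional 𝕜 F ∧ ∀ y, ∃ z ∈ R, y - z ∈ F := by
  constructor
  · intro h
    obtain ⟨F, hF⟩ := R.exists_isCompl
    refine ⟨F, (R.quotientEquivOfIsCompl F hF).finiteDimensional, fun y => ?_⟩
    obtain ⟨z, hz, v, hv, rfl⟩ := Submodule.mem_sup.1 (hF.sup_eq_top ▸ Submodule.mem_top (x := y))
    exact ⟨z, hz, by simpa using hv⟩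
  · rintro ⟨F, hF, h⟩
    refine Module.Finite.of_surjective (R.mkQ ∘ₗ F.subtype) fun q => ?_
    obtain ⟨y, rfl⟩ := R.mkQ_surjective q
    obtain ⟨z, hz, hv⟩ := h y
    refine ⟨⟨y - z, hv⟩, ?_⟩
    simpa using hz

theorem InfiniteCodim.mono {M N : Submodule 𝕜 Y} (h : M ≤ N) (hN : InfiniteCodim N) :
    InfiniteCodim M := by
  intro hM
  obtain ⟨F, hF, hFM⟩ := (finiteDimensional_quotient_iff M).1 hM
  refine hN ((finiteDimensional_quotient_iff N).2 ⟨F, hF, fun y => ?_⟩)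
  obtain ⟨z, hz, hv⟩ := hFM y
  exact ⟨z, h hz, hv⟩

theorem InfiniteCodim.sup_finiteDimensional {M : Submodule 𝕜 Y} (hM : InfiniteCodim M)
    (F : Submodule 𝕜 Y) [FiniteDimensional 𝕜 F] : InfiniteCodim (M ⊔ F) := by
  intro h
  obtain ⟨G, hG, hGM⟩ := (finiteDimensional_quotient_iff _).1 h
  refine hM ((finiteDimensional_quotient_iff M).2 ⟨F ⊔ G, inferInstance, fun y => ?_⟩)
  obtain ⟨z, hz, hv⟩ := hGM y
  obtain ⟨m, hm, v, hv', rfl⟩ := Submodule.mem_sup.1 hz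
  refine ⟨m, hm, ?_⟩
  have : y - m = v + (y - (m + v)) := by abel
  rw [this]
  exact Submodule.add_mem_sup hv' hv

/-- An operator between Banach spaces whose range has finite codimension has closed range. -/
theorem isClosed_range_of_finiteDimensional_quotient [CompleteSpace X] [CompleteSpace Y]
    (T : X →L[𝕜] Y) [h : FiniteDimensional 𝕜 (Y ⧸ T.range)] : IsClosed (T.range : Set Y) := by
  obtain ⟨F, hF⟩ := T.range.exists_isCompl
  have : FiniteDimensional 𝕜 F := (T.range.quotientEquivOfIsCompl F hF).finiteDimensional
  have : CompleteSpace F := FiniteDimensional.complete 𝕜 F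
  have hs : Function.Surjective (T.coprod F.subtypeL) := by
    intro y
    obtain ⟨z, ⟨x, rfl⟩, v, hv, rfl⟩ :=
      Submodule.mem_sup.1 (hF.sup_eq_top ▸ Submodule.mem_top (x := y))
    exact ⟨(x, ⟨v, hv⟩), by simp⟩
  -- By the open mapping theorem it suffices that the preimage in X × F is closed; it is X × {0}.
  rw [← ((T.coprod F.subtypeL).isQuotientMap hs).isClosed_preimage]
  have hz : IsClosed (Prod.snd ⁻¹' {0} : Set (X × F)) := isClosed_singleton.preimage continuous_snd
  suffices h : T.coprod F.subtypeL ⁻¹' T.range = Prod.snd ⁻¹' {0} from h ▸ hz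
  ext ⟨x, v⟩
  simp only [Set.mem_preimage, ContinuousLinearMap.coprod_apply, SetLike.mem_coe,
    Set.mem_singleton_iff]
  rw [Submodule.add_mem_iff_right _ (show T x ∈ T.range from ⟨x, rfl⟩)]
  constructor
  · intro hv
    exact Subtype.ext (Submodule.disjoint_def.1 hF.disjoint _ hv v.2)
  · rintro rfl
    simp

/-- Closedness of the range is automatic here, leaving a purely algebraic condition. -/
theorem mem_lowerSemiFredholm_iff [CompleteSpace X] [CompleteSpace Y] {T : X →L[𝕜] Y} :
    T ∈ lowerSemiFredholm 𝕜 X Y ↔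
      ∃ F : Submodule 𝕜 Y, FiniteDimensional 𝕜 F ∧ ∀ y, ∃ x, y - T x ∈ F := by
  have : T ∈ lowerSemiFredholm 𝕜 X Y ↔ FiniteDimensional 𝕜 (Y ⧸ T.range) :=
    ⟨fun h => h.2, fun h => ⟨isClosed_range_of_finiteDimensional_quotient T, h⟩⟩
  rw [this, finiteDimensional_quotient_iff]
  simp

theorem not_mem_lowerSemiFredholm_of_range_le {T : X →L[𝕜] Y} {N : Submodule 𝕜 Y}
    (hN : InfiniteCodim N) (h : ∀ x, T x ∈ N) : T ∉ lowerSemiFredholm 𝕜 X Y := by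
  intro hT
  refine hN.mono (M := T.range) ?_ hT.2
  rintro _ ⟨x, rfl⟩
  exact h x

/-- The lower semi-Fredholm operators form an open set. -/
theorem exists_forall_sub_mem_lowerSemiFredholm [CompleteSpace X] [CompleteSpace Y]
    {T : X →L[𝕜] Y} (hT : T ∈ lowerSemiFredholm 𝕜 X Y) :
    ∃ ε > 0, ∀ C : X →L[𝕜] Y, ‖C‖ ≤ ε → T - C ∈ lowerSemiFredholm 𝕜 X Y := by
  obtain ⟨F, hF, h⟩ := mem_lowerSemiFredholm_iff.1 hT
  have : CompleteSpace F := FiniteDimensional.complete 𝕜 F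
  have hs : Function.Surjective (T.coprod F.subtypeL) := by
    intro y
    obtain ⟨x, hx⟩ := h y
    exact ⟨(x, ⟨y - T x, hx⟩), by simp⟩
  obtain ⟨c, hc, hcT⟩ := (T.coprod F.subtypeL).exists_preimage_norm_le hs
  -- Preimages cost a factor c, so this bound on C leaves an error of at most half of ‖y‖.
  refine ⟨1 / (2 * c), by positivity, fun C hC => mem_lowerSemiFredholm_iff.2 ⟨F, hF, ?_⟩⟩
  have hs' : Function.Surjective ((T - C).coprod F.subtypeL) := by
    refine surjective_of_approx_preimage _ c fun y => ?_
    obtain ⟨⟨x, v⟩, hxv, hn⟩ := hcT y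
    refine ⟨(x, v), ?_, hn⟩
    have : y - ((T - C).coprod F.subtypeL) (x, v) = C x := by
      rw [← hxv]
      simp
    rw [this]
    calc ‖C x‖ ≤ ‖C‖ * ‖x‖ := C.le_opNorm x
      _ ≤ 1 / (2 * c) * (c * ‖y‖) := by
        gcongr
        exact (norm_fst_le (x, v)).trans hn
      _ = 1 / 2 * ‖y‖ := by field_simp
  intro y
  obtain ⟨⟨x, v⟩, rfl⟩ := hs' y
  exact ⟨x, by simp⟩

/-! ### Functionals almost annihilating a range, and small perturbations -/

/-- A functional whose real part is at most `u` on the closed ball of radius `R` has norm at most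
`u / R`. -/
theorem opNorm_mul_le_of_re_le {g : X →L[𝕜] 𝕜} {R u : ℝ} (hR : 0 < R)
    (h : ∀ x, ‖x‖ ≤ R → RCLike.re (g x) ≤ u) : ‖g‖ * R ≤ u := by
  have hu : 0 ≤ u := by simpa using h 0 (by simpa using hR.le)
  rw [← le_div_iff₀ hR]
  refine g.opNorm_le_bound (by positivity) fun x => ?_
  rcases eq_or_ne x 0 with rfl | hx
  · simp
  rcases eq_or_ne (g x) 0 with hgx | hgx
  · rw [hgx, norm_zero]; positivity
  have hx' : 0 < ‖x‖ := norm_pos_iff.2 hx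
  have hg' : (‖g x‖ : 𝕜) ≠ 0 := by simpa using hgx
  -- Rescale x to norm R and rotate it so that g takes a nonnegative real value.
  have key := h (((R / ‖x‖ : ℝ) * ((starRingEnd 𝕜) (g x) / ‖g x‖) : 𝕜) • x) (by
    rw [norm_smul, norm_mul, norm_div, RCLike.norm_conj]
    simp [hgx, abs_of_pos hR]
    field_simp
    exact le_rfl)
  have e : g (((R / ‖x‖ : ℝ) * ((starRingEnd 𝕜) (g x) / ‖g x‖) : 𝕜) • x)
      = ((R / ‖x‖ * ‖g x‖ : ℝ) : 𝕜) := by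
    rw [map_smul, smul_eq_mul, mul_assoc, div_mul_eq_mul_div, RCLike.conj_mul]
    push_cast
    field_simp
  rw [e, RCLike.ofReal_re] at key
  field_simp at key ⊢
  linarith

/-- If the range of `S` has infinite codimension, there are unit functionals vanishing on any
prescribed finite-dimensional subspace and almost annihilating the range of `S`. -/
theorem exists_functional_small_on_range [CompleteSpace X] (S : X →L[𝕜] Y)
    (hS : InfiniteCodim S.range) (F : Submodule 𝕜 Y) [FiniteDimensional 𝕜 F] {δ : ℝ}
    (hδ : 0 < δ) :
    ∃ f : Y →L[𝕜] 𝕜, ‖f‖ = 1 ∧ (∀ v ∈ F, f v = 0) ∧ ‖f ∘L S‖ ≤ δ := by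
  by_contra! hcon
  have hbound : ∀ f : Y →L[𝕜] 𝕜, (∀ v ∈ F, f v = 0) → δ * ‖f‖ ≤ ‖f ∘L S‖ := by
    intro f hf
    rcases eq_or_ne f 0 with rfl | hf0
    · simp
    have hn : 0 < ‖f‖ := norm_pos_iff.2 hf0
    have := hcon ((‖f‖⁻¹ : 𝕜) • f) (by simp [norm_smul, hn.ne']) (fun v hv => by simp [hf v hv])
    rw [ContinuousLinearMap.smul_comp, norm_smul, norm_inv, RCLike.norm_ofReal, abs_norm,
      inv_mul_eq_div, lt_div_iff₀ hn] at this
    exact this.le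
  have : CompleteSpace F := FiniteDimensional.complete 𝕜 F
  let : NormedSpace ℝ Y := NormedSpace.restrictScalars ℝ 𝕜 Y
  have : IsScalarTower ℝ 𝕜 Y := RestrictScalars.isScalarTower ℝ 𝕜 Y
  -- Otherwise Hahn–Banach separates y by some f; f vanishes on F, being bounded above there, and
  -- violates `hbound`.
  have hdense : ∀ y : Y, y ≠ 0 →
      y ∈ closure ((fun p : X × F => S p.1 + p.2) '' {p | ‖p.1‖ ≤ 2 * ‖y‖ / δ}) := by
    intro y hy
    have hy' : 0 < ‖y‖ := norm_pos_iff.2 hy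
    by_contra hmem
    set A := (fun p : X × F => S p.1 + p.2) '' {p | ‖p.1‖ ≤ 2 * ‖y‖ / δ} with hA
    have hconv : Convex ℝ A := by
      rintro _ ⟨⟨x₁, v₁⟩, h₁, rfl⟩ _ ⟨⟨x₂, v₂⟩, h₂, rfl⟩ a b ha hb hab
      refine ⟨((a : 𝕜) • x₁ + (b : 𝕜) • x₂, (a : 𝕜) • v₁ + (b : 𝕜) • v₂), ?_, ?_⟩
      · simp only [Set.mem_ofPred_eq] at h₁ h₂ ⊢
        calc ‖(a : 𝕜) • x₁ + (b : 𝕜) • x₂‖ ≤ a * ‖x₁‖ + b * ‖x₂‖ := by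
              refine (norm_add_le _ _).trans (le_of_eq ?_)
              simp [norm_smul, abs_of_nonneg ha, abs_of_nonneg hb]
          _ ≤ a * (2 * ‖y‖ / δ) + b * (2 * ‖y‖ / δ) := by gcongr
          _ = 2 * ‖y‖ / δ := by rw [← add_mul, hab, one_mul]
      · simp only [map_add, map_smul, Submodule.coe_add, Submodule.coe_smul,
          RCLike.real_smul_eq_coe_smul (K := 𝕜)]
        module
    obtain ⟨f, u, hfu, huy⟩ := RCLike.geometric_hahn_banach_closed_point (𝕜 := 𝕜)
      hconv.closure isClosed_closure hmem
    have hfA : ∀ x (v : F), ‖x‖ ≤ 2 * ‖y‖ / δ → RCLike.re (f (S x + v)) < u :=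
      fun x v hx => hfu _ (subset_closure ⟨(x, v), hx, rfl⟩)
    have hR : 0 < 2 * ‖y‖ / δ := by positivity
    have hfF : ∀ v ∈ F, f v = 0 := by
      intro v hv
      have hle : ∀ R > 0, ‖f ∘L F.subtypeL‖ * R ≤ u := fun R hR' =>
        opNorm_mul_le_of_re_le hR' fun w _ => by
          simpa using (hfA 0 w (by simpa using hR.le)).le
      have h0 : ‖f ∘L F.subtypeL‖ = 0 := by
        by_contra hne
        have hpos : 0 < ‖f ∘L F.subtypeL‖ := lt_of_le_of_ne (norm_nonneg _) (Ne.symm hne)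
        have hu : 0 < u := lt_of_lt_of_le (by positivity) (hle 1 one_pos)
        have := hle (2 * u / ‖f ∘L F.subtypeL‖) (by positivity)
        field_simp at this
        linarith
      exact congrArg (fun g : F →L[𝕜] 𝕜 => g ⟨v, hv⟩) (norm_eq_zero.1 h0)
    have h₁ : ‖f ∘L S‖ * (2 * ‖y‖ / δ) ≤ u := opNorm_mul_le_of_re_le hR fun x hx => by
      simpa using (hfA x 0 hx).le
    have h₂ : u < ‖f‖ * ‖y‖ :=
      huy.trans_le ((RCLike.re_le_norm _).trans (f.le_opNorm y))
    have h₃ : δ * ‖f‖ * (2 * ‖y‖ / δ) ≤ u :=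
      (mul_le_mul_of_nonneg_right (hbound f hfF) hR.le).trans h₁
    have h₄ : δ * ‖f‖ * (2 * ‖y‖ / δ) = 2 * (‖f‖ * ‖y‖) := by field_simp
    have h₅ : 0 ≤ ‖f‖ * ‖y‖ := by positivity
    linarith
  have hs : Function.Surjective (S.coprod F.subtypeL) := by
    refine surjective_of_approx_preimage _ (2 / δ + (3 / 2 + ‖S‖ * (2 / δ))) fun y => ?_
    rcases eq_or_ne y 0 with rfl | hy
    · exact ⟨0, by simp, by simp⟩
    have hy' : 0 < ‖y‖ := norm_pos_iff.2 hy
    obtain ⟨_, ⟨⟨x, v⟩, hx, rfl⟩, hd⟩ :=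
      Metric.mem_closure_iff.1 (hdense y hy) (1 / 2 * ‖y‖) (by positivity)
    rw [dist_eq_norm] at hd
    simp only [Set.mem_ofPred_eq] at hx hd
    refine ⟨(x, v), by simpa using hd.le, ?_⟩
    have hv : ‖v‖ ≤ (3 / 2 + ‖S‖ * (2 / δ)) * ‖y‖ := by
      have e : (v : Y) = y - S x - (y - (S x + v)) := by abel
      calc ‖v‖ = ‖(v : Y)‖ := rfl
        _ ≤ ‖y‖ + ‖S x‖ + ‖y - (S x + v)‖ := by
          conv_lhs => rw [e]
          exact (norm_sub_le _ _).trans (by gcongr; exact norm_sub_le _ _)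
        _ ≤ ‖y‖ + ‖S‖ * (2 * ‖y‖ / δ) + 1 / 2 * ‖y‖ := by
          gcongr
          exact S.le_opNorm_of_le hx
        _ = _ := by ring
    have h₁ : 0 ≤ 2 / δ * ‖y‖ := by positivity
    have h₂ : 0 ≤ (3 / 2 + ‖S‖ * (2 / δ)) * ‖y‖ := by positivity
    have h₃ : 2 * ‖y‖ / δ = 2 / δ * ‖y‖ := by ring
    rw [add_mul]
    exact max_le (by simp only; linarith) (by simp only; linarith)
  refine hS ((finiteDimensional_quotient_iff _).2 ⟨F, inferInstance, fun y => ?_⟩)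
  obtain ⟨⟨x, v⟩, rfl⟩ := hs y
  exact ⟨S x, ⟨x, rfl⟩, by simp⟩

/-- If the range of `S` has infinite codimension, there is a biorthogonal sequence in `Y` whose
functionals almost annihilate the range of `S`. -/
theorem exists_biorthogonal_small_on_range [CompleteSpace X] (S : X →L[𝕜] Y)
    (hS : InfiniteCodim S.range) (ε : ℕ → ℝ) (hε : ∀ n, 0 < ε n) :
    ∃ (f : ℕ → Y →L[𝕜] 𝕜) (y : ℕ → Y), (∀ n, f n (y n) = 1) ∧
      (∀ m n, m ≠ n → f m (y n) = 0) ∧ ∀ n, ‖f n ∘L S‖ * ‖y n‖ ≤ ε n := by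
  have step : ∀ (Q : Y →L[𝕜] Y) (η : ℝ), FiniteDimensional 𝕜 Q.range → 0 < η →
      ∃ (f : Y →L[𝕜] 𝕜) (y : Y), (∀ z, f (Q z) = 0) ∧ f y = 1 ∧
        (Q ∘L Q = Q → Q y = 0) ∧ ‖f ∘L S‖ * ‖y‖ ≤ η := by
    intro Q η hQ hη
    obtain ⟨f, hf, hfQ, hfS⟩ := exists_functional_small_on_range S hS Q.range
      (δ := η / (2 * (1 + ‖Q‖))) (by positivity)
    obtain ⟨x, hx⟩ := f.exists_lt_apply_of_lt_opNorm (r := 1 / 2) (by rw [hf]; norm_num)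
    have hfx : f x ≠ 0 := by
      rw [← norm_pos_iff]
      linarith [hx.2]
    have hfQ' : ∀ z, f (Q z) = 0 := fun z => hfQ _ ⟨z, rfl⟩
    let w := (f x)⁻¹ • x
    have hw : ‖w‖ ≤ 2 := by
      rw [norm_smul, norm_inv, inv_mul_le_iff₀ (norm_pos_iff.2 hfx)]
      linarith [hx.1, hx.2]
    refine ⟨f, w - Q w, hfQ', ?_, fun hQQ => ?_, ?_⟩
    · rw [map_sub, hfQ', sub_zero, map_smul, smul_eq_mul, inv_mul_cancel₀ hfx]
    · have : Q (Q w) = Q w := congrArg (fun g : Y →L[𝕜] Y => g w) hQQ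
      rw [map_sub, this, sub_self]
    · have hy : ‖w - Q w‖ ≤ 2 * (1 + ‖Q‖) := by
        calc ‖w - Q w‖ ≤ ‖w‖ + ‖Q‖ * ‖w‖ :=
              (norm_sub_le _ _).trans (by gcongr; exact Q.le_opNorm w)
          _ ≤ 2 + ‖Q‖ * 2 := by gcongr
          _ = _ := by ring
      calc ‖f ∘L S‖ * ‖w - Q w‖ ≤ η / (2 * (1 + ‖Q‖)) * (2 * (1 + ‖Q‖)) := by gcongr
        _ = η := by field_simp
  choose! f y hfQ hfy hQy hfS using step
  -- Q n = Σ_{i<n} f_i ⊗ y_i is a projection; f_n kills its range and y_n lies in its kernel, which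
  -- gives biorthogonality on both sides.
  let next : ℕ → (Y →L[𝕜] Y) → (Y →L[𝕜] Y) := fun n Q =>
    Q + (f Q (ε n)).smulRight (y Q (ε n))
  let Q : ℕ → Y →L[𝕜] Y := fun n => Nat.rec 0 next n
  have hQ0 : Q 0 = 0 := rfl
  have hQs : ∀ n z, Q (n + 1) z = Q n z + f (Q n) (ε n) z • y (Q n) (ε n) := fun n z => rfl
  have hfin : ∀ n, FiniteDimensional 𝕜 (Q n).range := by
    intro n
    induction n with
    | zero =>
      have : (Q 0).range = ⊥ := by simp [hQ0]
      rw [this]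
      infer_instance
    | succ n ih =>
      have hle : (Q (n + 1)).range ≤ (Q n).range ⊔ 𝕜 ∙ y (Q n) (ε n) := by
        rintro _ ⟨z, rfl⟩
        exact Submodule.add_mem_sup ⟨z, rfl⟩
          (Submodule.smul_mem _ _ (Submodule.mem_span_singleton_self _))
      exact Submodule.finiteDimensional_of_le hle
  have hproj : ∀ n, Q n ∘L Q n = Q n := by
    intro n
    induction n with
    | zero => simp [hQ0]
    | succ n ih =>
      ext z
      have h₁ := hfQ (Q n) (ε n) (hfin n) (hε n) z
      have h₂ := hfy (Q n) (ε n) (hfin n) (hε n)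
      have h₃ := hQy (Q n) (ε n) (hfin n) (hε n) ih
      have h₄ : Q n (Q n z) = Q n z := congrArg (fun g : Y →L[𝕜] Y => g z) ih
      simp [hQs, h₁, h₂, h₃, h₄]
  have hfy' : ∀ n, f (Q n) (ε n) (y (Q n) (ε n)) = 1 := fun n => hfy _ _ (hfin n) (hε n)
  have hQy' : ∀ n, Q n (y (Q n) (ε n)) = 0 := fun n => hQy _ _ (hfin n) (hε n) (hproj n)
  have hfQ' : ∀ n z, f (Q n) (ε n) (Q n z) = 0 := fun n => hfQ _ _ (hfin n) (hε n)
  have hfix : ∀ m n, m < n → (∀ z, f (Q m) (ε m) (Q n z) = f (Q m) (ε m) z) ∧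
      Q n (y (Q m) (ε m)) = y (Q m) (ε m) := by
    intro m n hmn
    induction n, hmn using Nat.le_induction with
    | base => exact ⟨fun z => by simp [hQs, hfQ', hfy'], by simp [hQs, hQy', hfy']⟩
    | succ n hmn ih =>
      have h₁ : f (Q m) (ε m) (y (Q n) (ε n)) = 0 := by rw [← ih.1, hQy', map_zero]
      have h₂ : f (Q n) (ε n) (y (Q m) (ε m)) = 0 := by rw [← ih.2, hfQ']
      exact ⟨fun z => by simp [hQs, ih.1, h₁], by simp [hQs, ih.2, h₂]⟩
  refine ⟨fun n => f (Q n) (ε n), fun n => y (Q n) (ε n), hfy', fun m n hmn => ?_,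
    fun n => hfS _ _ (hfin n) (hε n)⟩
  rcases hmn.lt_or_gt with h | h
  · simp only
    rw [← (hfix m n h).1, hQy', map_zero]
  · simp only
    rw [← (hfix n m h).2, hfQ']

/-- If `S` maps a closed subspace `E` onto a subspace of infinite codimension, then an arbitrarily
small perturbation of `S` maps `E` into a closed subspace of infinite codimension. -/
theorem exists_small_perturbation_mapsTo [CompleteSpace X] [CompleteSpace Y] (S : X →L[𝕜] Y)
    (E : Submodule 𝕜 X) (hE : IsClosed (E : Set X)) (hS : InfiniteCodim (S ∘L E.subtypeL).range)
    {ε : ℝ} (hε : 0 < ε) :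
    ∃ C : X →L[𝕜] Y, ‖C‖ ≤ ε ∧ ∃ W : Submodule 𝕜 Y, IsClosed (W : Set Y) ∧ InfiniteCodim W ∧
      ∀ x ∈ E, (S - C) x ∈ W := by
  have : CompleteSpace E := hE.completeSpace_coe
  obtain ⟨f, y, h1, h0, hsmall⟩ := exists_biorthogonal_small_on_range (S ∘L E.subtypeL) hS
    (fun n => ε / 2 / 2 ^ n) (fun n => by positivity)
  choose g hg hgn using fun n => exists_extension_norm_eq E (f n ∘L (S ∘L E.subtypeL))
  have hb : ∀ n, ‖(g n).smulRight (y n)‖ ≤ ε / 2 / 2 ^ n := fun n => by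
    rw [ContinuousLinearMap.norm_smulRight_apply, hgn]
    exact hsmall n
  have hsum : HasSum (fun n => ε / 2 / 2 ^ n) ε := hasSum_geometric_two' ε
  have hC : Summable fun n => (g n).smulRight (y n) := .of_norm_bounded hsum.summable hb
  refine ⟨∑' n, (g n).smulRight (y n), tsum_of_norm_bounded hsum hb,
    ⨅ n, (f n).ker, ?_, ?_, ?_⟩
  · rw [Submodule.coe_iInf]
    exact isClosed_iInter fun n => (f n).isClosed_ker
  · intro hfd
    have hli : LinearIndependent 𝕜 fun n => (⨅ n, (f n).ker).mkQ (y n) := by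
      rw [linearIndependent_iff']
      intro s c hc i hi
      simp only [← map_smul, ← map_sum] at hc
      rw [Submodule.mkQ_apply, Submodule.Quotient.mk_eq_zero, Submodule.mem_iInf] at hc
      have hci : f i (∑ j ∈ s, c j • y j) = 0 := hc i
      rw [map_sum, Finset.sum_eq_single_of_mem i hi
        (fun j _ hj => by simp [h0 i j hj.symm])] at hci
      simpa [h1] using hci
    exact Infinite.not_finite hli.finite
  · intro x hx
    rw [Submodule.mem_iInf]
    intro m
    have hx' : HasSum (fun n => f m (g n x • y n)) (f m ((∑' n, (g n).smulRight (y n)) x)) :=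
      (f m).hasSum (hC.hasSum.mapL (ContinuousLinearMap.apply 𝕜 Y x))
    have hx'' : HasSum (fun n => f m (g n x • y n)) (g m x) := by
      convert hasSum_single m ?_ using 1
      · simp [h1]
      · intro n hn
        simp [h0 m n hn.symm]
    have hgx : g m x = f m (S x) := hg m ⟨x, hx⟩
    change f m (S x - (∑' n, (g n).smulRight (y n)) x) = 0
    rw [map_sub, hx'.unique hx'', hgx, sub_self]

/-! ### Strictly cosingular operators are admissible -/

/-- Strictly cosingular operators are admissible perturbations of lower semi-Fredholm ones. -/
theorem strictlyCosingular_subset_perturbationClass [CompleteSpace X] [CompleteSpace Y] :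
    strictlyCosingular 𝕜 X Y ⊆ perturbationClass (lowerSemiFredholm 𝕜 X Y) := by
  intro K hK T hT
  by_contra hTK
  have hcodim : InfiniteCodim ((T + K) ∘L (⊤ : Submodule 𝕜 X).subtypeL).range := by
    intro h
    obtain ⟨F, hF, hFy⟩ := (finiteDimensional_quotient_iff _).1 h
    refine hTK (mem_lowerSemiFredholm_iff.2 ⟨F, hF, fun y => ?_⟩)
    obtain ⟨_, ⟨x, rfl⟩, hx⟩ := hFy y
    exact ⟨x, hx⟩
  obtain ⟨ε, hε, hopen⟩ := exists_forall_sub_mem_lowerSemiFredholm hT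
  obtain ⟨C, hC, W, hWc, hW, hCW⟩ :=
    exists_small_perturbation_mapsTo (T + K) ⊤ isClosed_univ hcodim hε
  obtain ⟨F, hF, hFy⟩ := mem_lowerSemiFredholm_iff.1 (hopen C hC)
  refine hK (W ⊔ F) (W.isClosed_sup_finiteDimensional F hWc) (hW.sup_finiteDimensional F)
    fun q => ?_
  obtain ⟨y, rfl⟩ := (W ⊔ F).mkQ_surjective q
  obtain ⟨x, hx⟩ := hFy y
  refine ⟨-x, ?_⟩
  simp only [Submodule.mkQ_apply]
  rw [eq_comm, Submodule.Quotient.eq]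
  have e : y - K (-x) = (T + K - C) x + (y - (T - C) x) := by
    simp only [map_neg, add_apply, sub_apply]
    abel
  rw [e]
  exact Submodule.add_mem_sup (hCW x trivial) hx

/-! ### Left composition and the converse inclusion -/

theorem equiv_comp_mem_lowerSemiFredholm [CompleteSpace X] [CompleteSpace Y] (U : Y ≃L[𝕜] Y)
    {T : X →L[𝕜] Y} (hT : T ∈ lowerSemiFredholm 𝕜 X Y) :
    (U : Y →L[𝕜] Y) ∘L T ∈ lowerSemiFredholm 𝕜 X Y := by
  obtain ⟨F, hF, h⟩ := mem_lowerSemiFredholm_iff.1 hT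
  refine mem_lowerSemiFredholm_iff.2 ⟨F.map (U : Y →ₗ[𝕜] Y), inferInstance, fun y => ?_⟩
  obtain ⟨x, hx⟩ := h (U.symm y)
  exact ⟨x, _, hx, by simp⟩

theorem equiv_comp_mem_perturbationClass [CompleteSpace X] [CompleteSpace Y] (U : Y ≃L[𝕜] Y)
    {K : X →L[𝕜] Y} (hK : K ∈ perturbationClass (lowerSemiFredholm 𝕜 X Y)) :
    (U : Y →L[𝕜] Y) ∘L K ∈ perturbationClass (lowerSemiFredholm 𝕜 X Y) := by
  intro T hT
  have e : T + (U : Y →L[𝕜] Y) ∘L K =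
      (U : Y →L[𝕜] Y) ∘L ((U.symm : Y →L[𝕜] Y) ∘L T + K) := by
    ext x
    simp
  rw [e]
  exact equiv_comp_mem_lowerSemiFredholm U (hK _ (equiv_comp_mem_lowerSemiFredholm U.symm hT))

/-- The perturbation class of `Φ₋(X, Y)` is stable under composition with operators on `Y`. -/
theorem comp_mem_perturbationClass [CompleteSpace X] [CompleteSpace Y] (B : Y →L[𝕜] Y)
    {K : X →L[𝕜] Y} (hK : K ∈ perturbationClass (lowerSemiFredholm 𝕜 X Y)) :
    B ∘L K ∈ perturbationClass (lowerSemiFredholm 𝕜 X Y) := by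
  have hunit : ∀ U : Y →L[𝕜] Y, IsUnit U →
      U ∘L K ∈ perturbationClass (lowerSemiFredholm 𝕜 X Y) := by
    rintro _ ⟨u, rfl⟩
    exact equiv_comp_mem_perturbationClass (ContinuousLinearEquiv.ofUnit u) hK
  -- As |c| > ‖B‖, B is the sum of the invertible operators c and -(c - B).
  set c : 𝕜 := ((‖B‖ + 1 : ℝ) : 𝕜) with hc
  have hcpos : 0 < ‖B‖ + 1 := by positivity
  have hc0 : c ≠ 0 := by
    rw [hc, RCLike.ofReal_ne_zero]
    exact hcpos.ne'
  have hcu : IsUnit (c • (1 : Y →L[𝕜] Y)) := (Units.mk0 c hc0 • (1 : (Y →L[𝕜] Y)ˣ)).isUnit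
  have hlt : ‖c⁻¹ • B‖ < 1 := by
    rw [norm_smul, norm_inv, hc, RCLike.norm_ofReal, abs_of_pos hcpos, inv_mul_lt_iff₀ hcpos]
    linarith
  have hBu : IsUnit (-(c • (1 - c⁻¹ • B))) :=
    ((Units.mk0 c hc0 • Units.oneSub (c⁻¹ • B) hlt).isUnit).neg
  intro T hT
  have e : T + B ∘L K = T + (c • (1 : Y →L[𝕜] Y)) ∘L K + (-(c • (1 - c⁻¹ • B))) ∘L K := by
    ext x
    simp [smul_sub, smul_smul, hc0]
  rw [e]
  exact hunit _ hBu _ (hunit _ hcu T hT)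

/-- An operator whose kernel contains that of a surjective operator factors through it. -/
theorem exists_comp_eq_of_ker_le {M : Type*} [NormedAddCommGroup M] [NormedSpace 𝕜 M]
    [CompleteSpace X] [CompleteSpace M] (q : X →L[𝕜] M) (hq : Function.Surjective q)
    (g : X →L[𝕜] Y) (h : ∀ x, q x = 0 → g x = 0) : ∃ A : M →L[𝕜] Y, ∀ x, A (q x) = g x := by
  have hcong : ∀ x x', q x = q x' → g x = g x' := fun x x' hx => by
    rw [← sub_eq_zero, ← map_sub]
    exact h _ (by rw [map_sub, hx, sub_self])
  obtain ⟨c, -, hc⟩ := q.exists_preimage_norm_le hq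
  choose s hs hsn using hc
  let A : M →ₗ[𝕜] Y :=
    { toFun := fun m => g (s m)
      map_add' := fun a b => by
        rw [← map_add]
        exact hcong _ _ (by rw [map_add, hs, hs, hs])
      map_smul' := fun a b => by
        rw [RingHom.id_apply, ← map_smul]
        exact hcong _ _ (by rw [map_smul, hs, hs]) }
  refine ⟨A.mkContinuous (‖g‖ * c) fun m => ?_, fun x => hcong _ _ (hs _)⟩
  rw [mul_assoc]
  exact g.le_opNorm_of_le (hsn m)

/-- A complemented subspace is the kernel of a bounded projection. -/
theorem exists_projection_of_closedComplemented {N : Submodule 𝕜 Y} (hN : N.ClosedComplemented) :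
    ∃ P : Y →L[𝕜] Y, (∀ y ∈ N, P y = 0) ∧ ∀ y, y - P y ∈ N := by
  obtain ⟨p, hp⟩ := hN
  refine ⟨ContinuousLinearMap.id 𝕜 Y - N.subtypeL ∘L p, fun y hy => ?_, fun y => ?_⟩
  · simp [hp ⟨y, hy⟩]
  · simp

/-- Admissible perturbations of lower semi-Fredholm operators into a superprojective space are
strictly cosingular. -/
theorem perturbationClass_subset_strictlyCosingular [CompleteSpace X] [CompleteSpace Y]
    (hne : (lowerSemiFredholm 𝕜 X Y).Nonempty) (hY : Superprojective 𝕜 Y) :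
    perturbationClass (lowerSemiFredholm 𝕜 X Y) ⊆ strictlyCosingular 𝕜 X Y := by
  intro K hK Z hZc hZ hsurj
  obtain ⟨T, hT⟩ := hne
  obtain ⟨N, hZN, hN, hNc⟩ := hY Z hZc hZ
  obtain ⟨P, hPN, hP⟩ := exists_projection_of_closedComplemented hNc
  have hNclosed : IsClosed (N : Set Y) := hNc.isClosed
  have hKN : ∀ y, ∃ x, y - K x ∈ N := fun y => by
    obtain ⟨x, hx⟩ := hsurj (Z.mkQ y)
    exact ⟨x, hZN ((Submodule.Quotient.eq Z).1 hx.symm)⟩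
  let E : Submodule 𝕜 X := N.comap (K : X →ₗ[𝕜] Y)
  have hE : IsClosed (E : Set X) := hNclosed.preimage K.continuous
  by_cases hTE : InfiniteCodim (T ∘L E.subtypeL).range
  · obtain ⟨ε, hε, hopen⟩ := exists_forall_sub_mem_lowerSemiFredholm hT
    obtain ⟨C, hC, W, hWc, hW, hCW⟩ := exists_small_perturbation_mapsTo T E hE hTE hε
    obtain ⟨N₁, hWN₁, hN₁, hN₁c⟩ := hY W hWc hW
    obtain ⟨P₁, hP₁N, hP₁⟩ := exists_projection_of_closedComplemented hN₁c
    have hq : Function.Surjective (N.mkQL ∘L K) := fun q => by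
      obtain ⟨y, rfl⟩ := N.mkQ_surjective q
      obtain ⟨x, hx⟩ := hKN y
      exact ⟨x, ((Submodule.Quotient.eq N).2 hx).symm⟩
    obtain ⟨A, hA⟩ := exists_comp_eq_of_ker_le (N.mkQL ∘L K) hq (-(P₁ ∘L (T - C))) fun x hx => by
      have hxE : x ∈ E := (Submodule.Quotient.mk_eq_zero N).1 hx
      exact neg_eq_zero.2 (hP₁N _ (hWN₁ (hCW x hxE)))
    have hmem := comp_mem_perturbationClass (A ∘L N.mkQL) hK _ (hopen C hC)
    refine not_mem_lowerSemiFredholm_of_range_le hN₁ (fun x => ?_) hmem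
    have hAx : A (N.mkQL (K x)) = -P₁ ((T - C) x) := hA x
    change (T - C) x + A (N.mkQL (K x)) ∈ N₁
    rw [hAx, ← sub_eq_add_neg]
    exact hP₁ _
  · obtain ⟨F, hF, hFy⟩ := (finiteDimensional_quotient_iff _).1 (not_not.1 hTE)
    let R : Y →L[𝕜] Y := ContinuousLinearMap.id 𝕜 Y - P
    have hR : ∀ y, R y ∈ N := hP
    have hT' : R ∘L T - P ∘L K ∈ lowerSemiFredholm 𝕜 X Y := by
      refine mem_lowerSemiFredholm_iff.2 ⟨F.map (R : Y →ₗ[𝕜] Y), inferInstance, fun y => ?_⟩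
      obtain ⟨x₁, hx₁⟩ := hKN y
      -- Since PKx₁ = Py and PKx₂ = 0, the error at x₂ - x₁ is R(y + Tx₁ - Tx₂) ∈ R(F).
      obtain ⟨_, ⟨⟨x₂, hx₂⟩, rfl⟩, hv⟩ := hFy (y + T x₁)
      refine ⟨x₂ - x₁, _, hv, ?_⟩
      have e₁ : P y = P (K x₁) := by
        rw [← sub_eq_zero, ← map_sub]
        exact hPN _ hx₁
      have e₂ : P (K x₂) = 0 := hPN _ hx₂
      simp [R, e₁, e₂]
      abel
    have hmem := comp_mem_perturbationClass P hK _ hT'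
    refine not_mem_lowerSemiFredholm_of_range_le hN (fun x => ?_) hmem
    simpa using hR (T x)

end SemiFredholm

theorem theorem4 {𝕜 X Y : Type*} [RCLike 𝕜]
    [NormedAddCommGroup X] [NormedSpace 𝕜 X] [CompleteSpace X]
    [NormedAddCommGroup Y] [NormedSpace 𝕜 Y] [CompleteSpace Y]
    (hne : (SemiFredholm.lowerSemiFredholm 𝕜 X Y).Nonempty)
    (hY : SemiFredholm.Superprojective 𝕜 Y) :
    SemiFredholm.perturbationClass (SemiFredholm.lowerSemiFredholm 𝕜 X Y) =
      SemiFredholm.strictlyCosingular 𝕜 X Y :=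
  (SemiFredholm.perturbationClass_subset_strictlyCosingular hne hY).antisymm
    SemiFredholm.strictlyCosingular_subset_perturbationClass
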